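/- **Setting.** Let $M$ be a finite-dimensional smooth ($C^\infty$) Hausdorff manifold without boundary, $\pi:TM\to M$ its tangent bundle, and $\pi_*:T_vTM\to T_{\pi(v)}M$ the differential of $\pi$ at $v\in TM$. Let $\mathcal V_v=\ker \pi_*\subset T_vTM$ be the vertical space at $v$, let $\mathcal J_v:T_{\pi(v)}M\to\mathcal V_v$ be the vertical lift (the differential at $v$ of the inclusion of the vector space $T_{\pi(v)}M$ into $TM$), which is a linear isomorphism, and put $K=\mathcal J_v^{-1}:\mathcal V_v\to T_{\pi(v)}M$. A (possibly nonlinear) *connection* on $TM$ is a smooth vector subbundle $\mathcal H$ of $TTM\to TM$ with $T_vTM=\mathcal H_v\oplus\mathcal V_v$ for all $v\in TM$. Let $H_v:T_vTM\to T_vTM$ be the projection onto $\mathcal H_v$ with kernel $\mathcal V_v$. The *geodesic quasispray* of $\mathcal H$ is the vector field on $TM$ $$S(v)=\left(\pi_*|_{\mathcal H_v}\right)^{-1}(v)\in T_vTM,\qquad v\in TM.$$ The *covariant derivative* of $\mathcal H$ is defined for smooth vector fields $U,V$ on $M$ by $$(\nabla_UV)_p=K\big(V_*U_p-H_{V_p}V_*U_p\big)\in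 T_pM ,\qquad p\in M,$$ where $V_*:T_pM\to T_{V_p}TM$ is the differential of $V:M\to TM$. Let $\bar{\mathcal H}$ and $\mathcal H$ be two connections on $TM$ with covariant derivatives $\bar\nabla$ and $\nabla$. Their *difference operator* is $\mathcal D(U,V)=\bar\nabla_UV-\nabla_UV$. The value $\mathcal D(U,V)_p$ depends only on $U_p$ and $V_p$, so $\mathcal D(u,v)\in T_pM$ is defined for all $u,v\in T_pM$, $p\in M$. The operator $\mathcal D$ is called *alternating* if it vanishes on the diagonal of $TM\oplus TM$, that is, if $\mathcal D(v,v)=0$ for all $v\in TM$. **Theorem.** Two connections $\bar{\mathcal H}$ and $\mathcal H$ on $TM$ have the same geodesic quasispray, $\bar S=S$, if and only if their difference operator $\mathcal D=\bar\nabla-\nabla$ is alternating. -/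

import Mathlib

open Bundle Set
open scoped Manifold ContDiff Topology

noncomputable section

namespace Ehresmann

section TangentBundle

variable {E : Type*} [NormedAddCommGroup E] [NormedSpace ℝ E]
  {H : Type*} [TopologicalSpace H] {I : ModelWithCorners ℝ E H}
  {M : Type*} [TopologicalSpace M] [ChartedSpace H M] [IsManifold I ∞ M]

/-- The differential `π_* : T_v TM → T_p M`, `p = π v`, of the projection `π : TM → M`. -/
def projDeriv (v : TangentBundle I M) :
    TangentSpace I.tangent v →L[ℝ] TangentSpace I v.proj :=
  mfderiv I.tangent I (π E (TangentSpace I : M → Type _)) v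

/-- The vertical space `𝒱_v = ker π_*` in `T_v TM`. -/
def vertical (v : TangentBundle I M) : Submodule ℝ (TangentSpace I.tangent v) :=
  LinearMap.ker (projDeriv v).toLinearMap

/-- The vertical lift `𝒥_v : T_p M → T_v TM`, `p = π v`: the differential at `v` of the
inclusion of the vector space `T_p M` (modelled on `E`) into `TM` as the fibre over `p`. -/
def verticalLift (v : TangentBundle I M) :
    TangentSpace I v.proj →L[ℝ] TangentSpace I.tangent v :=
  mfderiv 𝓘(ℝ, E) I.tangent (fun w : E => (⟨v.proj, w⟩ : TangentBundle I M)) v.snd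

theorem projDeriv_apply (v : TangentBundle I M) (z : TangentSpace I.tangent v) :
    projDeriv v z = (z : E × E).1 := by
  have h : HasMFDerivAt I.tangent I (π E (TangentSpace I : M → Type _)) v
      (ContinuousLinearMap.fst ℝ E E) := by
    refine ⟨(FiberBundle.continuous_proj E (TangentSpace I : M → Type _)).continuousAt, ?_⟩
    have h1 : HasFDerivWithinAt (fun y : E × E => y.1) (ContinuousLinearMap.fst ℝ E E)
        (range I.tangent) (extChartAt I.tangent v v) := hasFDerivWithinAt_fst
    have h2 : ∀ y ∈ (extChartAt I.tangent v).target, writtenInExtChartAt I.tangent I v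
        (π E (TangentSpace I : M → Type _)) y = y.1 := by
      intro y hy
      have e : (extChartAt I.tangent v).symm y ∈ (extChartAt I.tangent v).source :=
        (extChartAt I.tangent v).map_target hy
      have e2 := (extChartAt I.tangent v).right_inv hy
      conv_rhs => rw [← e2]
      simp only [writtenInExtChartAt, Function.comp_apply]
      rw [FiberBundle.extChartAt]
      simp only [mfld_simps]
    refine h1.congr_of_eventuallyEq ?_ (h2 _ (mem_extChartAt_target v))
    filter_upwards [extChartAt_target_mem_nhdsWithin (I := I.tangent) v] with y hy
    exact h2 y hy
  rw [projDeriv, h.mfderiv]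
  rfl

theorem verticalLift_apply (v : TangentBundle I M) (w : TangentSpace I v.proj) :
    (verticalLift v w : E × E) = ((0 : E), (w : E)) := by
  have h : HasMFDerivAt 𝓘(ℝ, E) I.tangent (fun w : E => (⟨v.proj, w⟩ : TangentBundle I M)) v.snd
      (ContinuousLinearMap.inr ℝ E E) := by
    refine ⟨?_, ?_⟩
    · have h0 : Continuous (fun w : TangentSpace I v.proj => (⟨v.proj, w⟩ : TangentBundle I M)) :=
        FiberBundle.continuous_totalSpaceMk E (TangentSpace I : M → Type _) v.proj
      exact h0.continuousAt
    · have h1 : HasFDerivWithinAt (fun w : E => (extChartAt I v.proj v.proj, w))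
          (ContinuousLinearMap.inr ℝ E E) (range 𝓘(ℝ, E))
          (@extChartAt ℝ E E E _ _ _ _ _ 𝓘(ℝ, E) _ v.snd v.snd) :=
        (hasFDerivAt_prodMk_right _ _).hasFDerivWithinAt
      refine h1.congr (fun w _ => ?_) ?_
      all_goals
        simp only [writtenInExtChartAt, Function.comp_apply]
        rw [FiberBundle.extChartAt]
        simp only [mfld_simps]
        exact Prod.ext rfl (tangentCoordChange_self (mem_extChartAt_source v.proj))
  rw [verticalLift, h.mfderiv]
  rfl

theorem projDeriv_verticalLift (v : TangentBundle I M) (w : TangentSpace I v.proj) :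
    projDeriv v (verticalLift v w) = 0 := by
  rw [projDeriv_apply, verticalLift_apply]; rfl

/-- The vertical lift as a linear map onto the vertical space. -/
def verticalLiftOnto (v : TangentBundle I M) : TangentSpace I v.proj →ₗ[ℝ] vertical v :=
  (verticalLift v).toLinearMap.codRestrict (vertical v) (projDeriv_verticalLift v)

theorem verticalLiftOnto_bijective (v : TangentBundle I M) :
    Function.Bijective (verticalLiftOnto v) := by
  constructor
  · intro w w' h
    have h1 : verticalLift v w = verticalLift v w' := congrArg Subtype.val h
    have h2 : ((0 : E), (w : E)) = ((0 : E), (w' : E)) := by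
      rw [← verticalLift_apply, ← verticalLift_apply, h1]
    exact congrArg Prod.snd h2
  · rintro ⟨z, hz⟩
    refine ⟨(z : E × E).2, Subtype.ext ?_⟩
    have h1 : (z : E × E).1 = 0 := by
      rw [← projDeriv_apply]; exact hz
    change verticalLift v (z : E × E).2 = z
    refine (verticalLift_apply v _).trans ?_
    exact Prod.ext h1.symm rfl

/-- The canonical isomorphism `K : 𝒱_v → T_p M`, `p = π v`, inverse to the vertical lift. -/
def K (v : TangentBundle I M) : vertical v ≃ₗ[ℝ] TangentSpace I v.proj :=
  (LinearEquiv.ofBijective (verticalLiftOnto v) (verticalLiftOnto_bijective v)).symm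

variable (I M) in
/-- Smooth vector fields on `M`. -/
abbrev VField : Type _ := ContMDiffSection I E ∞ (TangentSpace I : M → Type _)

/-- The tangent vector `V_* u ∈ T_{V p} TM` for a vector field `V : M → TM` and `u ∈ T_p M`. -/
def pushforward (V : VField I M) (p : M) (u : TangentSpace I p) :
    TangentSpace I.tangent (⟨p, V p⟩ : TangentBundle I M) :=
  mfderiv I I.tangent (fun q => (⟨q, V q⟩ : TangentBundle I M)) p u

theorem projDeriv_pushforward (V : VField I M) (p : M) (u : TangentSpace I p) :
    projDeriv (⟨p, V p⟩ : TangentBundle I M) (pushforward V p u) = u := by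
  have hV : MDifferentiableAt I I.tangent (fun q => (⟨q, V q⟩ : TangentBundle I M)) p :=
    (V.contMDiff.mdifferentiable (by simp)) p
  have hp : MDifferentiableAt I.tangent I (π E (TangentSpace I : M → Type _))
      (⟨p, V p⟩ : TangentBundle I M) :=
    mdifferentiableAt_proj (TangentSpace I : M → Type _)
  have h := mfderiv_comp p hp hV
  have h1 := DFunLike.congr_fun h u
  refine h1.symm.trans ?_
  change mfderiv I I id p u = u
  rw [mfderiv_id]
  rfl

/-- Every tangent vector is the value of a smooth global vector field. -/
theorem exists_vField [FiniteDimensional ℝ E] [T2Space M] (p : M) (u : TangentSpace I p) :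
    ∃ U : VField I M, U p = u := by
  obtain ⟨s, hs, hsm⟩ := FiberBundle.exists_contMDiffOn_extend (k := ∞) I E u
  obtain ⟨t, hts, ht, hpt⟩ := mem_nhds_iff.1 hs
  obtain ⟨f, -, hf⟩ := (SmoothBumpFunction.nhds_basis_tsupport (I := I) p).mem_iff.1
    (ht.mem_nhds hpt)
  refine ⟨⟨_, ContMDiffOn.smul_section_of_tsupport f.contMDiff.contMDiffOn ht hf
    (hsm.mono hts)⟩, ?_⟩
  change f p • FiberBundle.extend E u p = u
  simp

/-- A family of subspaces `𝓗_v ⊆ T_v TM` is a smooth subbundle of `TTM → TM` if locally on `TM`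
it has a frame of smooth vector fields. -/
def IsSmoothSubbundle
    (𝓗 : ∀ v : TangentBundle I M, Submodule ℝ (TangentSpace I.tangent v)) : Prop :=
  ∀ v₀ : TangentBundle I M, ∃ U ∈ 𝓝 v₀, ∃ (k : ℕ)
    (X : Fin k → ∀ v : TangentBundle I M, TangentSpace I.tangent v),
    (∀ i, ContMDiffOn I.tangent I.tangent.tangent ∞
      (fun v => (⟨v, X i v⟩ : TangentBundle I.tangent (TangentBundle I M))) U) ∧
    ∀ v ∈ U, LinearIndependent ℝ (fun i => X i v) ∧
      Submodule.span ℝ (range fun i => X i v) = 𝓗 v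

end TangentBundle

/-- A (possibly nonlinear) connection on `TM`: a smooth subbundle `𝓗` of `TTM → TM` which is
complementary to the vertical bundle. -/
structure Connection {E : Type*} [NormedAddCommGroup E] [NormedSpace ℝ E]
    {H : Type*} [TopologicalSpace H] (I : ModelWithCorners ℝ E H)
    (M : Type*) [TopologicalSpace M] [ChartedSpace H M] [IsManifold I ∞ M] where
  /-- the horizontal spaces `𝓗_v ⊆ T_v TM` -/
  horizontal : ∀ v : TangentBundle I M, Submodule ℝ (TangentSpace I.tangent v)
  smooth : IsSmoothSubbundle horizontal
  isCompl : ∀ v, IsCompl (horizontal v) (vertical v)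

section Connection

variable {E : Type*} [NormedAddCommGroup E] [NormedSpace ℝ E]
  {H : Type*} [TopologicalSpace H] {I : ModelWithCorners ℝ E H}
  {M : Type*} [TopologicalSpace M] [ChartedSpace H M] [IsManifold I ∞ M]

namespace Connection

/-- The restriction of `π_*` to the horizontal space `𝓗_v`. -/
def projHorizontal (𝓗 : Connection I M) (v : TangentBundle I M) :
    𝓗.horizontal v →ₗ[ℝ] TangentSpace I v.proj :=
  (projDeriv v).toLinearMap.domRestrict (𝓗.horizontal v)

theorem projHorizontal_bijective (𝓗 : Connection I M) (v : TangentBundle I M) :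
    Function.Bijective (𝓗.projHorizontal v) := by
  have hc := 𝓗.isCompl v
  constructor
  · rw [injective_iff_map_eq_zero]
    rintro ⟨z, hz⟩ h
    have : z ∈ 𝓗.horizontal v ⊓ vertical v := ⟨hz, h⟩
    rw [hc.inf_eq_bot] at this
    exact Subtype.ext this
  · intro u
    let z : TangentSpace I.tangent v := ((u, 0) : E × E)
    have hz : projDeriv v z = u := projDeriv_apply v z
    refine ⟨⟨_, Submodule.projection_apply_mem hc z⟩, ?_⟩
    have h : projDeriv v (z - (𝓗.horizontal v).projection (vertical v) hc z) = 0 :=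
      Submodule.sub_projection_mem hc z
    rw [map_sub, sub_eq_zero, hz] at h
    exact h.symm

/-- The geodesic quasispray `S(v) = (π_*|_{𝓗_v})⁻¹ v`, a vector field on `TM`. -/
def geodesicQuasispray (𝓗 : Connection I M) (v : TangentBundle I M) :
    TangentSpace I.tangent v :=
  ((LinearEquiv.ofBijective (𝓗.projHorizontal v) (𝓗.projHorizontal_bijective v)).symm v.snd :
    𝓗.horizontal v)

/-- The geodesic quasispray is a second-order differential equation: `π_* S(v) = v`. -/
theorem projDeriv_geodesicQuasispray (𝓗 : Connection I M) (v : TangentBundle I M) :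
    projDeriv v (𝓗.geodesicQuasispray v) = v.snd :=
  (LinearEquiv.ofBijective (𝓗.projHorizontal v) (𝓗.projHorizontal_bijective v)).apply_symm_apply
    v.snd

/-- The horizontal projection `H_v : T_v TM → T_v TM`, with image `𝓗_v` and kernel `𝒱_v`. -/
def horizontalProj (𝓗 : Connection I M) (v : TangentBundle I M) :
    TangentSpace I.tangent v →ₗ[ℝ] TangentSpace I.tangent v :=
  (𝓗.horizontal v).projection (vertical v) (𝓗.isCompl v)

theorem sub_horizontalProj_mem (𝓗 : Connection I M) (v : TangentBundle I M)
    (z : TangentSpace I.tangent v) : z - 𝓗.horizontalProj v z ∈ vertical v :=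
  Submodule.sub_projection_mem (𝓗.isCompl v) z

/-- The connector `κ z = K (z - H_v z)` for `z ∈ T_v TM`. -/
def connector (𝓗 : Connection I M) (v : TangentBundle I M) (z : TangentSpace I.tangent v) :
    TangentSpace I v.proj :=
  K v ⟨z - 𝓗.horizontalProj v z, 𝓗.sub_horizontalProj_mem v z⟩

/-- The covariant derivative `∇_U V = κ (V_* U)`. -/
def covDeriv (𝓗 : Connection I M) (U V : VField I M) (p : M) : TangentSpace I p :=
  𝓗.connector ⟨p, V p⟩ (pushforward V p (U p))

end Connection

/-- The difference operator `𝒟(U, V) = ∇̄_U V - ∇_U V` of two connections, on vector fields. -/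
def difference (𝓗' 𝓗 : Connection I M) (U V : VField I M) (p : M) : TangentSpace I p :=
  𝓗'.covDeriv U V p - 𝓗.covDeriv U V p

/-- The value of `𝒟(U, V)` at `p` depends only on `U p` and `V p`. -/
theorem difference_congr (𝓗' 𝓗 : Connection I M) {U V U₁ V₁ : VField I M} {p : M}
    (hU : U p = U₁ p) (hV : V p = V₁ p) :
    difference 𝓗' 𝓗 U V p = difference 𝓗' 𝓗 U₁ V₁ p := by
  have key : ∀ (v w : TangentSpace I p) (z : TangentSpace I.tangent (⟨p, v⟩ : TangentBundle I M))
      (z₁ : TangentSpace I.tangent (⟨p, w⟩ : TangentBundle I M)), v = w →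
      projDeriv _ z = projDeriv _ z₁ →
      𝓗'.connector _ z - 𝓗.connector _ z = 𝓗'.connector _ z₁ - 𝓗.connector _ z₁ := by
    rintro v _ z z₁ rfl h
    have hz : z - z₁ ∈ vertical (⟨p, v⟩ : TangentBundle I M) := by
      change projDeriv _ (z - z₁) = 0
      rw [map_sub, h, sub_self]
    have hH : ∀ 𝓚 : Connection I M, 𝓚.horizontalProj _ z = 𝓚.horizontalProj _ z₁ := by
      intro 𝓚
      rw [← sub_eq_zero, ← map_sub]
      exact (Submodule.projection_apply_eq_zero_iff (𝓚.isCompl _)).2 hz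
    simp only [Connection.connector]
    rw [← map_sub, ← map_sub]
    congr 1
    apply Subtype.ext
    simp only [AddSubgroupClass.coe_sub]
    rw [hH, hH]
    abel
  exact key _ _ _ _ hV (by rw [projDeriv_pushforward, projDeriv_pushforward, hU])

variable [FiniteDimensional ℝ E] [T2Space M]

/-- The difference operator on `TM ⊕ TM`: `𝒟(u, v) = 𝒟(U, V)(p)` for `u, v ∈ T_p M` and any
vector fields `U`, `V` with `U p = u` and `V p = v`, see `differenceAt_eq`. -/
def differenceAt (𝓗' 𝓗 : Connection I M) (p : M) (u v : TangentSpace I p) : TangentSpace I p :=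
  difference 𝓗' 𝓗 (exists_vField p u).choose (exists_vField p v).choose p

theorem differenceAt_eq (𝓗' 𝓗 : Connection I M) (U V : VField I M) (p : M) :
    differenceAt 𝓗' 𝓗 p (U p) (V p) = difference 𝓗' 𝓗 U V p :=
  difference_congr 𝓗' 𝓗 (exists_vField p (U p)).choose_spec (exists_vField p (V p)).choose_spec

/-- The difference operator is alternating: it vanishes on the diagonal of `TM ⊕ TM`. -/
def DifferenceIsAlternating (𝓗' 𝓗 : Connection I M) : Prop :=
  ∀ (p : M) (v : TangentSpace I p), differenceAt 𝓗' 𝓗 p v v = 0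

end Connection

end Ehresmann

end

namespace Ehresmann

variable {E : Type*} [NormedAddCommGroup E] [NormedSpace ℝ E]
  {H : Type*} [TopologicalSpace H] {I : ModelWithCorners ℝ E H}
  {M : Type*} [TopologicalSpace M] [ChartedSpace H M] [IsManifold I ∞ M]

/-- The geodesic quasispray at `v` is the horizontal part of any `z ∈ T_v TM` with `π_* z = v`. -/
theorem Connection.horizontalProj_eq_geodesicQuasispray (𝓗 : Connection I M)
    (v : TangentBundle I M) (z : TangentSpace I.tangent v) (hz : projDeriv v z = v.snd) :
    𝓗.horizontalProj v z = 𝓗.geodesicQuasispray v := by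
  have hS : 𝓗.geodesicQuasispray v ∈ 𝓗.horizontal v := Subtype.property _
  have hv : z - 𝓗.geodesicQuasispray v ∈ vertical v := by
    change projDeriv v (z - 𝓗.geodesicQuasispray v) = 0
    rw [map_sub, hz, 𝓗.projDeriv_geodesicQuasispray, sub_self]
  have h0 : 𝓗.horizontalProj v (z - 𝓗.geodesicQuasispray v) = 0 :=
    (Submodule.projection_apply_eq_zero_iff (𝓗.isCompl v)).2 hv
  have h1 : 𝓗.horizontalProj v (𝓗.geodesicQuasispray v) = 𝓗.geodesicQuasispray v :=
    Submodule.projection_apply_left (𝓗.isCompl v) ⟨_, hS⟩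
  rw [map_sub, h1, sub_eq_zero] at h0
  exact h0

/-- Two connectors agree on `z` exactly when the horizontal projections agree on `z`. -/
theorem Connection.connector_eq_iff (𝓗' 𝓗 : Connection I M) (v : TangentBundle I M)
    (z : TangentSpace I.tangent v) :
    𝓗'.connector v z = 𝓗.connector v z ↔ 𝓗'.horizontalProj v z = 𝓗.horizontalProj v z := by
  rw [Connection.connector, Connection.connector, (K v).injective.eq_iff, Subtype.mk.injEq]
  exact sub_right_inj

/-- The difference operator vanishes on `(V p, V p)` exactly when the geodesic quasisprays agree
at `V p`. -/
theorem difference_self_eq_zero_iff (𝓗' 𝓗 : Connection I M) (V : VField I M) (p : M) :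
    difference 𝓗' 𝓗 V V p = 0 ↔
      𝓗'.geodesicQuasispray ⟨p, V p⟩ = 𝓗.geodesicQuasispray ⟨p, V p⟩ := by
  have hz := projDeriv_pushforward V p (V p)
  rw [← 𝓗'.horizontalProj_eq_geodesicQuasispray _ _ hz,
    ← 𝓗.horizontalProj_eq_geodesicQuasispray _ _ hz, ← Connection.connector_eq_iff]
  exact sub_eq_zero

end Ehresmann

theorem mainTheorem3 {E : Type*} [NormedAddCommGroup E] [NormedSpace ℝ E] [FiniteDimensional ℝ E]
    {H : Type*} [TopologicalSpace H] {I : ModelWithCorners ℝ E H} [I.Boundaryless]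
    {M : Type*} [TopologicalSpace M] [ChartedSpace H M] [IsManifold I ∞ M] [T2Space M]
    (𝓗' 𝓗 : Ehresmann.Connection I M) :
    𝓗'.geodesicQuasispray = 𝓗.geodesicQuasispray ↔
      Ehresmann.DifferenceIsAlternating 𝓗' 𝓗 := by
  constructor
  · intro h p v
    obtain ⟨V, rfl⟩ := Ehresmann.exists_vField p v
    rw [Ehresmann.differenceAt_eq, Ehresmann.difference_self_eq_zero_iff, h]
  · intro h
    funext ⟨p, v⟩
    obtain ⟨V, rfl⟩ := Ehresmann.exists_vField p v
    rw [← Ehresmann.difference_self_eq_zero_iff, ← Ehresmann.differenceAt_eq]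
    exact h p (V p)
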